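/- Let $d,n\ge 1$ and let $\Phi(a,b)=\varphi(\|a-b\|_2)$ be a radial kernel on $\mathbb R^d$ with $\varphi:[0,\infty)\to\mathbb R$. Suppose that $\Phi$ is (strictly) positive definite, i.e. for every finite set of distinct points of $\mathbb R^d$ the kernel matrix is positive definite, and analytic, i.e. for some $\rho>0$ there is a convergent expansion $\varphi(r)=\sum_{k\ge0}a_k r^{2k}$ for $0\le r<\rho$. Let $X=\{x_1,\dots,x_n\}\subset\mathbb R^d$ be distinct points and $Y=(y_1,\dots,y_n)\in\mathbb R^n$ data values, not all zero. For $\varepsilon>0$ let $\Phi_\varepsilon(a,b)=\varphi(\varepsilon\|a-b\|_2)$ and let $s_\varepsilon=\sum_{j=1}^n\alpha_j\Phi_\varepsilon(\cdot,x_j)$ be the interpolant with $s_\varepsilon(x_k)=y_k$ for $1\le k\le n$. Assume that the situation is nondegenerate, i.e. that the flat limit $p_0(z)=\lim_{\varepsilon\to0+}s_\varepsilon(z)$ exists in $\mathbb R$ for every $z\in\mathbb R^d$. Let $\Omega\subset\mathbb R^d$ be compact with nonempty interior and measure errors by $\|g\|_{\infty,\Omega}=\sup_{z\in\Omega}|g(z)|$.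 Call the flat limit error-optimal for $f$ if $\|f-p_0\|_{\infty,\Omega}\le\|f-s_\varepsilon\|_{\infty,\Omega}$ for all $\varepsilon>0$. Then the data $(X,Y)$ do not decide whether the flat limit is error-optimal. More precisely, there are functions $f_1,f_2,f_3:\mathbb R^d\to\mathbb R$, which can even be chosen as polynomials, with $f_i(x_j)=y_j$ for $1\le j\le n$ and $i=1,2,3$, such that 1. the flat limit is error-optimal for $f_1$; 2. $\|f_2-p_0\|_{\infty,\Omega}>0$, and the flat limit is strictly locally optimal for $f_2$: $\|f_2-p_0\|_{\infty,\Omega}<\|f_2-s_\varepsilon\|_{\infty,\Omega}$ for all sufficiently small $\varepsilon>0$; 3. the flat limit is not error-optimal for $f_3$, not even locally: $\|f_3-s_\varepsilon\|_{\infty,\Omega}<\|f_3-p_0\|_{\infty,\Omega}$ for all sufficiently small $\varepsilon>0$. -/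

import Mathlib

open Filter Topology
open scoped ENNReal

noncomputable section

/-- The scaled radial kernel `Φ_ε(a, b) = φ (ε ‖a - b‖₂)` on `ℝ^d`. The profile `φ` is only ever
evaluated at nonnegative arguments. -/
def scaledKernel {d : ℕ} (φ : ℝ → ℝ) (ε : ℝ) (a b : EuclideanSpace ℝ (Fin d)) : ℝ :=
  φ (ε * ‖a - b‖)

/-- The kernel matrix with entries `Φ_ε(x_j, x_k)`. -/
def kernelMatrix {d n : ℕ} (φ : ℝ → ℝ) (ε : ℝ) (x : Fin n → EuclideanSpace ℝ (Fin d)) :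
    Matrix (Fin n) (Fin n) ℝ :=
  Matrix.of fun j k => scaledKernel φ ε (x j) (x k)

/-- `(a, b) ↦ φ (‖a - b‖₂)` is a (strictly) positive definite kernel on `ℝ^d`: every kernel matrix
on finitely many distinct points is positive definite. -/
def IsPositiveDefiniteKernel (d : ℕ) (φ : ℝ → ℝ) : Prop :=
  ∀ (n : ℕ) (x : Fin n → EuclideanSpace ℝ (Fin d)), Function.Injective x →
    (kernelMatrix φ 1 x).PosDef

/-- The radial kernel is analytic: it has a convergent expansion into powers of the squared
distance (like `(1 + r²)⁻¹`, it need not converge for all distances). -/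
def IsAnalyticKernel (φ : ℝ → ℝ) : Prop :=
  ∃ (a : ℕ → ℝ) (ρ : ℝ), 0 < ρ ∧
    ∀ r : ℝ, 0 ≤ r → r < ρ → HasSum (fun k : ℕ => a k * (r ^ 2) ^ k) (φ r)

/-- The kernel interpolant `s = ∑ j, α_j Φ_ε(·, x_j)`, where `α` solves the linear system
`∑ j, α_j Φ_ε(x_k, x_j) = y_k`. -/
def kernelInterpolant {d n : ℕ} (φ : ℝ → ℝ) (ε : ℝ) (x : Fin n → EuclideanSpace ℝ (Fin d))
    (y : Fin n → ℝ) (z : EuclideanSpace ℝ (Fin d)) : ℝ :=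
  ∑ j, (((kernelMatrix φ ε x)⁻¹).mulVec y) j * scaledKernel φ ε z (x j)

/-- `p` is the flat limit of the interpolants to the data `(x, y)`: the pointwise limit for
`ε → 0`, `ε > 0`. -/
def IsFlatLimit {d n : ℕ} (φ : ℝ → ℝ) (x : Fin n → EuclideanSpace ℝ (Fin d)) (y : Fin n → ℝ)
    (p : EuclideanSpace ℝ (Fin d) → ℝ) : Prop :=
  ∀ z, Tendsto (fun ε : ℝ => kernelInterpolant φ ε x y z) (𝓝[>] 0) (𝓝 (p z))

/-- The maximum-norm distance `sup_{z ∈ Ω} |f z - g z|`, with values in `[0, ∞]`. -/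
def supError {d : ℕ} (Ω : Set (EuclideanSpace ℝ (Fin d)))
    (f g : EuclideanSpace ℝ (Fin d) → ℝ) : ℝ≥0∞ :=
  ⨆ z ∈ Ω, ‖f z - g z‖ₑ

/-- `f` is a polynomial function on `ℝ^d`. -/
def IsPolynomialFun {d : ℕ} (f : EuclideanSpace ℝ (Fin d) → ℝ) : Prop :=
  ∃ P : MvPolynomial (Fin d) ℝ, ∀ z, f z = MvPolynomial.eval (fun i => z i) P

/-- Error-optimality of the flat limit `p` for the function `f`: no scale `ε > 0` yields a smaller
error on `Ω` than the flat limit. -/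
def IsFlatLimitOptimal {d n : ℕ} (φ : ℝ → ℝ) (x : Fin n → EuclideanSpace ℝ (Fin d))
    (y : Fin n → ℝ) (p : EuclideanSpace ℝ (Fin d) → ℝ) (Ω : Set (EuclideanSpace ℝ (Fin d)))
    (f : EuclideanSpace ℝ (Fin d) → ℝ) : Prop :=
  ∀ ε : ℝ, 0 < ε → supError Ω f p ≤ supError Ω f (kernelInterpolant φ ε x y)

end

/-!
For `ε → 0+` the interpolants approach the flat limit along a fixed nonzero polynomial: there are a
polynomial `q ≠ 0` and an order `m > 0` such that `s_ε = p₀ + ε^(2m) (q + o(1))`, uniformly on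
bounded sets (`exists_flat_expansion`). At the nodes `s_ε` and `p₀` take the values `y`, so `q`
vanishes there, and `p₀`, `p₀ - q`, `p₀ + q` all interpolate the data. The flat limit has error `0`
for `p₀`. For `p₀ - q` its error is `q`, and replacing `p₀` by `s_ε` enlarges the maximum norm by a
factor of about `1 + ε^(2m)`; for `p₀ + q` it shrinks it by a factor of about `1 - ε^(2m)`.

The expansion comes from Cramer's rule. Near `t = ε² = 0` the kernel matrix is analytic in `t`, and
its determinant is `t^K` times a nonvanishing analytic function, since it is nonzero for `t > 0`.
Hence `t^K s_ε(z)` is a power series in `t` whose coefficients are polynomials in `z`, dominated on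
each ball by one convergent series (`exists_hasSum_kernelInterpolant`). Existence of the flat limit
forces the coefficients below order `K` to vanish and identifies the one of order `K` with `p₀`
(`coeff_eq_of_tendsto`).

It remains to see that some later coefficient is nonzero. Otherwise `s_ε = p₀` on any prescribed
ball for small `ε`. A finite difference of order above the degree of `p₀`, taken along a line,
annihilates `p₀`. Applied to `s_ε`, it gives a nontrivial combination of kernel translates that
vanishes at all of its own centers, contrary to positive definiteness
(`exists_radius_kernelInterpolant_ne`).
-/

/-! ### Positive definiteness at every scale -/

theorem kernelMatrix_posDef {d n : ℕ} {φ : ℝ → ℝ} (hposdef : IsPositiveDefiniteKernel d φ)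
    {ε : ℝ} (hε : 0 < ε) {x : Fin n → EuclideanSpace ℝ (Fin d)} (hx : Function.Injective x) :
    (kernelMatrix φ ε x).PosDef := by
  have h := hposdef n (fun j => ε • x j) fun i j hij => hx (smul_right_injective _ hε.ne' hij)
  have e : kernelMatrix φ ε x = kernelMatrix φ 1 (fun j => ε • x j) := by
    ext i j
    simp [kernelMatrix, scaledKernel, ← smul_sub, norm_smul, abs_of_pos hε]
  rwa [e]

/-- A nontrivial combination of kernel translates at distinct centers cannot vanish at all of these
centers. -/
theorem eq_zero_of_sum_scaledKernel_eq_zero {d : ℕ} {ι : Type*} [Fintype ι] {φ : ℝ → ℝ}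
    (hposdef : IsPositiveDefiniteKernel d φ) {ε : ℝ} (hε : 0 < ε)
    {u : ι → EuclideanSpace ℝ (Fin d)} (hu : Function.Injective u) (β : ι → ℝ)
    (h : ∀ i, ∑ j, β j * scaledKernel φ ε (u i) (u j) = 0) : β = 0 := by
  set e := Fintype.equivFin ι
  by_contra hβ
  have hne : β ∘ e.symm ≠ 0 := fun h0 => hβ <| funext fun i => by
    simpa using congrFun h0 (e i)
  have hpos := (kernelMatrix_posDef hposdef hε (hu.comp e.symm.injective)).dotProduct_mulVec_pos hne
  have hz : (kernelMatrix φ ε (u ∘ e.symm)).mulVec (β ∘ e.symm) = 0 := by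
    funext i
    simp only [Matrix.mulVec, dotProduct, kernelMatrix, Matrix.of_apply, Function.comp_apply,
      Pi.zero_apply]
    rw [← h (e.symm i), ← e.symm.sum_comp]
    exact Finset.sum_congr rfl fun j _ => mul_comm _ _
  simp [hz] at hpos

theorem kernelInterpolant_apply_node {d n : ℕ} {φ : ℝ → ℝ}
    (hposdef : IsPositiveDefiniteKernel d φ) {ε : ℝ} (hε : 0 < ε)
    {x : Fin n → EuclideanSpace ℝ (Fin d)} (hx : Function.Injective x) (y : Fin n → ℝ)
    (i : Fin n) : kernelInterpolant φ ε x y (x i) = y i := by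
  have hdet := (Matrix.isUnit_iff_isUnit_det _).1 (kernelMatrix_posDef hposdef hε hx).isUnit
  have h : (kernelMatrix φ ε x).mulVec ((kernelMatrix φ ε x)⁻¹.mulVec y) i = y i := by
    rw [Matrix.mulVec_mulVec, Matrix.mul_nonsing_inv _ hdet, Matrix.one_mulVec]
  rw [← h, kernelInterpolant]
  exact Finset.sum_congr rfl fun j _ => mul_comm _ _

/-! ### Power series in the squared scale -/

/-- An analytic profile is, on a neighbourhood of the origin, a power series in the squared
distance, with absolute convergence on a common interval. -/
theorem IsAnalyticKernel.exists_analyticAt {φ : ℝ → ℝ} (h : IsAnalyticKernel φ) :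
    ∃ (ψ : ℝ → ℝ) (a : ℕ → ℝ) (σ : ℝ), 0 < σ ∧ AnalyticAt ℝ ψ 0 ∧
      (∀ u, |u| < σ → Summable fun k => ‖a k * u ^ k‖) ∧
      (∀ u, |u| < σ → HasSum (fun k => a k * u ^ k) (ψ u)) ∧
      ∀ r, 0 ≤ r → r ^ 2 < σ → φ r = ψ (r ^ 2) := by
  obtain ⟨a, ρ, hρ, ha⟩ := h
  have hsum : ∀ u, |u| < ρ ^ 2 → Summable fun k => ‖a k * u ^ k‖ := by
    intro u hu
    have h1 := (ha (√|u|) (Real.sqrt_nonneg _) (by rwa [Real.sqrt_lt' hρ])).summable.norm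
    simpa [Real.sq_sqrt (abs_nonneg u)] using h1
  have hhas : ∀ u, |u| < ρ ^ 2 → HasSum (fun k => a k * u ^ k) (∑' k, a k * u ^ k) :=
    fun u hu => (hsum u hu).of_norm.hasSum
  refine ⟨fun u => ∑' k, a k * u ^ k, a, ρ ^ 2, by positivity, ?_, hsum, hhas, ?_⟩
  · refine ⟨FormalMultilinearSeries.ofScalars ℝ a, hasFPowerSeriesAt_iff.2 ?_⟩
    filter_upwards [eventually_abs_sub_lt 0 (show (0 : ℝ) < ρ ^ 2 by positivity)] with u hu
    simpa [FormalMultilinearSeries.coeff_ofScalars, mul_comm] using hhas u (by simpa using hu)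
  · intro r hr hrσ
    exact ((hhas _ (by rwa [abs_of_nonneg (sq_nonneg r)])).unique
      (ha r hr (lt_of_pow_lt_pow_left₀ 2 hρ.le hrσ))).symm

theorem AnalyticAt.matrix_det {n : ℕ} {A : ℝ → Matrix (Fin n) (Fin n) ℝ} {t₀ : ℝ}
    (hA : ∀ i j, AnalyticAt ℝ (fun t => A t i j) t₀) : AnalyticAt ℝ (fun t => (A t).det) t₀ := by
  simp only [Matrix.det_apply']
  exact Finset.analyticAt_fun_sum _ fun σ _ =>
    analyticAt_const.mul (Finset.analyticAt_fun_prod _ fun i _ => hA _ _)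

theorem AnalyticAt.matrix_adjugate {n : ℕ} {A : ℝ → Matrix (Fin n) (Fin n) ℝ} {t₀ : ℝ}
    (hA : ∀ i j, AnalyticAt ℝ (fun t => A t i j) t₀) (i j : Fin n) :
    AnalyticAt ℝ (fun t => (A t).adjugate i j) t₀ := by
  simp only [Matrix.adjugate_apply]
  refine AnalyticAt.matrix_det fun k l => ?_
  by_cases hk : k = j
  · subst hk
    simpa using analyticAt_const
  · simpa [Matrix.updateRow_ne hk] using hA k l

/-- The interpolation coefficients are Laurent series in `ε ^ 2`: multiplied by a power of `ε ^ 2`,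
the order of the zero at the origin of the kernel determinant, they become power series. -/
theorem exists_hasSum_coefficients {d n : ℕ} {φ : ℝ → ℝ} (hanalytic : IsAnalyticKernel φ)
    (hposdef : IsPositiveDefiniteKernel d φ) {x : Fin n → EuclideanSpace ℝ (Fin d)}
    (hx : Function.Injective x) (y : Fin n → ℝ) :
    ∃ (K : ℕ) (c : Fin n → ℕ → ℝ) (τ : ℝ), 0 < τ ∧ ∀ ε, 0 < ε → ε ^ 2 ≤ τ → ∀ j,
      HasSum (fun k => c j k * (ε ^ 2) ^ k)
        ((ε ^ 2) ^ K * ((kernelMatrix φ ε x)⁻¹.mulVec y) j) := by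
  obtain ⟨ψ, a, σ, hσ, hψ, -, -, hφ⟩ := hanalytic.exists_analyticAt
  set A : ℝ → Matrix (Fin n) (Fin n) ℝ := fun t => Matrix.of fun i j => ψ (t * ‖x i - x j‖ ^ 2)
    with hAdef
  have hA : ∀ i j, AnalyticAt ℝ (fun t => A t i j) 0 := fun i j =>
    AnalyticAt.fun_comp (g := ψ) (by simpa using hψ) (analyticAt_id.mul analyticAt_const)
  -- For small scales the kernel matrix is the value at `ε ^ 2` of an analytic family.
  have hev : ∀ᶠ t in 𝓝 (0 : ℝ), ∀ i j, |t * ‖x i - x j‖ ^ 2| < σ := by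
    simp only [eventually_all]
    intro i j
    have hc : Continuous fun t : ℝ => |t * ‖x i - x j‖ ^ 2| := by fun_prop
    exact hc.continuousAt.eventually_lt continuousAt_const (by simpa using hσ)
  have hker : ∀ᶠ t in 𝓝 (0 : ℝ), ∀ ε, 0 < ε → ε ^ 2 = t → kernelMatrix φ ε x = A t := by
    filter_upwards [hev] with t ht ε hε hεt
    ext i j
    have h1 := lt_of_abs_lt (ht i j)
    rw [← hεt, ← mul_pow] at h1
    simp only [kernelMatrix, scaledKernel, hAdef, Matrix.of_apply, ← hεt, ← mul_pow]
    exact hφ _ (by positivity) h1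
  have hdet0 : ¬∀ᶠ t in 𝓝 (0 : ℝ), (A t).det = 0 := by
    intro h0
    have h1 : ∀ᶠ t in 𝓝[>] (0 : ℝ), (A t).det = 0 ∧
        (∀ ε, 0 < ε → ε ^ 2 = t → kernelMatrix φ ε x = A t) ∧ 0 < t :=
      (h0.filter_mono nhdsWithin_le_nhds).and
        ((hker.filter_mono nhdsWithin_le_nhds).and self_mem_nhdsWithin)
    obtain ⟨t, ht0, hk, ht⟩ := h1.exists
    have hs := Real.sqrt_pos.2 ht
    have hu := (Matrix.isUnit_iff_isUnit_det _).1 (kernelMatrix_posDef hposdef hs hx).isUnit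
    rw [hk _ hs (Real.sq_sqrt ht.le), ht0] at hu
    exact hu.ne_zero rfl
  obtain ⟨K, g, hg, hg0, hgA⟩ :=
    (AnalyticAt.matrix_det hA).exists_eventuallyEq_pow_smul_nonzero_iff.2 hdet0
  have hC : ∀ j, AnalyticAt ℝ (fun t => (∑ i, (A t).adjugate j i * y i) / g t) 0 := fun j =>
    (Finset.analyticAt_fun_sum _ fun i _ =>
      (AnalyticAt.matrix_adjugate hA j i).mul analyticAt_const).div hg hg0
  choose p hp using hC
  have hall : ∀ᶠ t in 𝓝 (0 : ℝ), ∀ j, HasSum (fun k => t ^ k • (p j).coeff k)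
      ((∑ i, (A t).adjugate j i * y i) / g t) := by
    simp only [eventually_all]
    intro j
    simpa using hasFPowerSeriesAt_iff.1 (hp j)
  have hfin := (hall.and (hker.and (hgA.and (hg.continuousAt.eventually_ne hg0))))
  obtain ⟨τ, hτ, hball⟩ := Metric.eventually_nhds_iff.1 hfin
  refine ⟨K, fun j => (p j).coeff, τ / 2, by positivity, fun ε hε hετ j => ?_⟩
  have hε2 : 0 < ε ^ 2 := by positivity
  obtain ⟨h1, h2, h3, h4⟩ := hball (y := ε ^ 2) (by
    rw [Real.dist_eq, sub_zero, abs_of_pos hε2]; linarith)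
  convert h1 j using 1
  · funext k
    simp [mul_comm]
  · rw [h2 ε hε rfl, Matrix.inv_def, Ring.inverse_eq_inv', h3, Matrix.smul_mulVec]
    simp only [Pi.smul_apply, smul_eq_mul, Matrix.mulVec, dotProduct, sub_zero]
    field_simp

/-- The `k`-th coefficient in `t` of
`∑ j, (∑ i, c j i * t ^ i) * (∑ l, a l * (t * ‖z - x j‖²) ^ l)`, as a polynomial in `z`. -/
noncomputable def flatCoeff {d n : ℕ} (x : Fin n → EuclideanSpace ℝ (Fin d)) (a : ℕ → ℝ)
    (c : Fin n → ℕ → ℝ) (k : ℕ) : MvPolynomial (Fin d) ℝ :=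
  ∑ j, ∑ q ∈ Finset.HasAntidiagonal.antidiagonal k, MvPolynomial.C (c j q.1 * a q.2) *
    (∑ i, (MvPolynomial.X i - MvPolynomial.C (x j i)) ^ 2) ^ q.2

theorem eval_flatCoeff {d n : ℕ} (x : Fin n → EuclideanSpace ℝ (Fin d)) (a : ℕ → ℝ)
    (c : Fin n → ℕ → ℝ) (k : ℕ) (z : EuclideanSpace ℝ (Fin d)) :
    MvPolynomial.eval (fun i => z i) (flatCoeff x a c k) =
      ∑ j, ∑ q ∈ Finset.HasAntidiagonal.antidiagonal k, c j q.1 * a q.2 * (‖z - x j‖ ^ 2) ^ q.2 := by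
  simp [flatCoeff, EuclideanSpace.real_norm_sq_eq]

/-- Up to a fixed power of `ε ^ 2`, the interpolant is a power series in `ε ^ 2` whose coefficients
are polynomials in the evaluation point. On each ball it is dominated by one convergent series. -/
theorem exists_hasSum_kernelInterpolant {d n : ℕ} {φ : ℝ → ℝ} (hanalytic : IsAnalyticKernel φ)
    (hposdef : IsPositiveDefiniteKernel d φ) {x : Fin n → EuclideanSpace ℝ (Fin d)}
    (hx : Function.Injective x) (y : Fin n → ℝ) :
    ∃ (K : ℕ) (M : ℕ → MvPolynomial (Fin d) ℝ), ∀ R : ℝ, ∃ (τ : ℝ) (B : ℕ → ℝ), 0 < τ ∧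
      Summable B ∧
      (∀ z : EuclideanSpace ℝ (Fin d), ‖z‖ ≤ R → ∀ k,
        |MvPolynomial.eval (fun i => z i) (M k)| * τ ^ k ≤ B k) ∧
      ∀ z : EuclideanSpace ℝ (Fin d), ‖z‖ ≤ R → ∀ ε, 0 < ε → ε ^ 2 ≤ τ →
        HasSum (fun k => MvPolynomial.eval (fun i => z i) (M k) * (ε ^ 2) ^ k)
          ((ε ^ 2) ^ K * kernelInterpolant φ ε x y z) := by
  obtain ⟨ψ, a, σ, hσ, -, hsum, hψsum, hφ⟩ := hanalytic.exists_analyticAt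
  obtain ⟨K, c, τ₀, hτ₀, hc⟩ := exists_hasSum_coefficients hanalytic hposdef hx y
  refine ⟨K, flatCoeff x a c, fun R => ?_⟩
  obtain ⟨S, hS⟩ : ∃ S, ∀ j, ‖x j‖ ≤ S :=
    ⟨∑ i, ‖x i‖, fun j => Finset.single_le_sum (f := fun i => ‖x i‖)
      (fun _ _ => norm_nonneg _) (Finset.mem_univ j)⟩
  set W : ℝ := (R + S) ^ 2
  have hW0 : 0 ≤ W := sq_nonneg _
  have hdist : ∀ z : EuclideanSpace ℝ (Fin d), ‖z‖ ≤ R → ∀ j, ‖z - x j‖ ^ 2 ≤ W := fun z hz j =>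
    pow_le_pow_left₀ (norm_nonneg _) ((norm_sub_le _ _).trans (add_le_add hz (hS j))) 2
  set τ : ℝ := min τ₀ (σ / (W + 1))
  have hτ : 0 < τ := lt_min hτ₀ (by positivity)
  have hτW : τ * W < σ := by
    have h1 : τ * (W + 1) ≤ σ := (le_div_iff₀ (by positivity)).1 (min_le_right _ _)
    nlinarith
  have hcs : ∀ j t, 0 < t → t ≤ τ → Summable fun k => ‖c j k * t ^ k‖ := fun j t ht htτ => by
    have h1 := (hc (√t) (Real.sqrt_pos.2 ht)
      (by rw [Real.sq_sqrt ht.le]; exact htτ.trans (min_le_left _ _)) j).summable.norm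
    simpa only [Real.sq_sqrt ht.le] using h1
  have hatau : Summable fun k => ‖a k * (τ * W) ^ k‖ :=
    hsum _ (by rwa [abs_of_nonneg (by positivity)])
  refine ⟨τ, fun k => ∑ j, ∑ q ∈ Finset.HasAntidiagonal.antidiagonal k,
    ‖c j q.1 * τ ^ q.1‖ * ‖a q.2 * (τ * W) ^ q.2‖, hτ, ?_, ?_, ?_⟩
  · refine summable_sum fun j _ => ?_
    refine (summable_norm_sum_mul_antidiagonal_of_summable_norm
      (f := fun k => ‖c j k * τ ^ k‖) (g := fun k => ‖a k * (τ * W) ^ k‖) ?_ ?_).of_norm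
    · simpa only [norm_norm] using hcs j τ hτ le_rfl
    · simpa only [norm_norm] using hatau
  · intro z hz k
    rw [eval_flatCoeff, ← abs_of_nonneg (pow_nonneg hτ.le k), ← abs_mul, Finset.sum_mul]
    refine (Finset.abs_sum_le_sum_abs _ _).trans (Finset.sum_le_sum fun j _ => ?_)
    rw [Finset.sum_mul]
    refine (Finset.abs_sum_le_sum_abs _ _).trans (Finset.sum_le_sum fun q hq => ?_)
    rw [← Finset.HasAntidiagonal.mem_antidiagonal.1 hq, ← norm_mul, ← Real.norm_eq_abs]
    rw [show c j q.1 * a q.2 * (‖z - x j‖ ^ 2) ^ q.2 * τ ^ (q.1 + q.2) =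
        (c j q.1 * τ ^ q.1 * (a q.2 * τ ^ q.2)) * (‖z - x j‖ ^ 2) ^ q.2 by ring,
      show c j q.1 * τ ^ q.1 * (a q.2 * (τ * W) ^ q.2) =
        (c j q.1 * τ ^ q.1 * (a q.2 * τ ^ q.2)) * W ^ q.2 by rw [mul_pow]; ring,
      norm_mul _ ((‖z - x j‖ ^ 2) ^ q.2), norm_mul _ (W ^ q.2)]
    refine mul_le_mul_of_nonneg_left ?_ (norm_nonneg _)
    rw [Real.norm_of_nonneg (by positivity), Real.norm_of_nonneg (by positivity)]
    exact pow_le_pow_left₀ (by positivity) (hdist z hz j) _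
  · intro z hz ε hε hετ
    have hε2 : 0 < ε ^ 2 := by positivity
    have hlt : ∀ j, |ε ^ 2 * ‖z - x j‖ ^ 2| < σ := fun j => by
      rw [abs_of_nonneg (by positivity)]
      exact (mul_le_mul hετ (hdist z hz j) (by positivity) hτ.le).trans_lt hτW
    have hj : ∀ j, HasSum (fun k => ∑ q ∈ Finset.HasAntidiagonal.antidiagonal k,
        c j q.1 * (ε ^ 2) ^ q.1 * (a q.2 * (ε ^ 2 * ‖z - x j‖ ^ 2) ^ q.2))
        ((ε ^ 2) ^ K * ((kernelMatrix φ ε x)⁻¹.mulVec y) j * scaledKernel φ ε z (x j)) := by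
      intro j
      have h1 := hcs j _ hε2 hετ
      have h2 := hsum _ (hlt j)
      have h3 : scaledKernel φ ε z (x j) = ψ (ε ^ 2 * ‖z - x j‖ ^ 2) := by
        rw [scaledKernel, hφ _ (by positivity) (by rw [mul_pow]; exact lt_of_abs_lt (hlt j)),
          mul_pow]
      rw [h3, ← (hc ε hε (hετ.trans (min_le_left _ _)) j).tsum_eq, ← (hψsum _ (hlt j)).tsum_eq,
        tsum_mul_tsum_eq_tsum_sum_antidiagonal_of_summable_norm h1 h2]
      exact (summable_norm_sum_mul_antidiagonal_of_summable_norm h1 h2).of_norm.hasSum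
    convert hasSum_sum (s := Finset.univ) fun j _ => hj j using 1
    · funext k
      rw [eval_flatCoeff, Finset.sum_mul]
      refine Finset.sum_congr rfl fun j _ => ?_
      rw [Finset.sum_mul]
      refine Finset.sum_congr rfl fun q hq => ?_
      rw [← Finset.HasAntidiagonal.mem_antidiagonal.1 hq, pow_add, mul_pow _ _ q.2]
      ring
    · rw [kernelInterpolant, Finset.mul_sum]
      exact Finset.sum_congr rfl fun j _ => by ring

/-! ### Leading terms of dominated power series -/

theorem abs_hasSum_sub_leading_le {m B : ℕ → ℝ} {t τ F : ℝ} {k : ℕ} (ht : 0 < t) (htτ : t ≤ τ)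
    (hB : Summable B) (hmB : ∀ i, |m i| * τ ^ i ≤ B i) (hF : HasSum (fun i => m i * t ^ i) F)
    (hm : ∀ i < k, m i = 0) : |F - m k * t ^ k| ≤ (∑' i, B i) / τ ^ (k + 1) * t ^ (k + 1) := by
  have hτ : 0 < τ := ht.trans_le htτ
  have hB0 : ∀ i, 0 ≤ B i := fun i => le_trans (by positivity) (hmB i)
  have h1 := hF.sub (hasSum_ite_eq k (m k * t ^ k))
  have h2 := hB.hasSum.mul_right ((t / τ) ^ (k + 1))
  have h3 := tsum_of_norm_bounded h2 (f := fun i => m i * t ^ i - if i = k then m k * t ^ k else 0)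
    fun i => by
      rcases lt_trichotomy i k with hik | hik | hik
      · rw [hm i hik, if_neg hik.ne]
        simpa using mul_nonneg (hB0 i) (by positivity)
      · subst hik
        simpa using mul_nonneg (hB0 i) (by positivity)
      · rw [if_neg hik.ne', sub_zero, norm_mul, norm_pow, Real.norm_eq_abs,
          Real.norm_of_nonneg ht.le]
        calc |m i| * t ^ i = |m i| * τ ^ i * (t / τ) ^ i := by
              rw [div_pow]; field_simp
          _ ≤ B i * (t / τ) ^ (k + 1) := by
              refine mul_le_mul (hmB i) ?_ (by positivity) (hB0 i)
              exact pow_le_pow_of_le_one (by positivity) ((div_le_one hτ).2 htτ) hik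
  rw [h1.tsum_eq, Real.norm_eq_abs, div_pow] at h3
  calc |F - m k * t ^ k| ≤ _ := h3
    _ = _ := by ring

theorem eventually_sq_le {τ : ℝ} (hτ : 0 < τ) : ∀ᶠ ε in 𝓝[>] (0 : ℝ), 0 < ε ∧ ε ^ 2 ≤ τ := by
  filter_upwards [Ioc_mem_nhdsGT (Real.sqrt_pos.2 hτ)] with ε hε
  exact ⟨hε.1, (Real.le_sqrt hε.1.le hτ.le).1 hε.2⟩

theorem tendsto_sq_nhdsGT_zero : Tendsto (fun ε : ℝ => ε ^ 2) (𝓝[>] 0) (𝓝 0) := by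
  have h : Continuous fun ε : ℝ => ε ^ 2 := by fun_prop
  simpa using (h.tendsto 0).mono_left nhdsWithin_le_nhds

/-- If `(ε²)^K * s ε` is a power series in `ε²` and `s ε` converges for `ε → 0+`, then the series
starts at the order `K`, with the limit of `s` as its leading coefficient. -/
theorem coeff_eq_of_tendsto {m B : ℕ → ℝ} {τ p : ℝ} {K : ℕ} {s : ℝ → ℝ} (hτ : 0 < τ)
    (hB : Summable B) (hmB : ∀ i, |m i| * τ ^ i ≤ B i)
    (hs : ∀ ε, 0 < ε → ε ^ 2 ≤ τ → HasSum (fun i => m i * (ε ^ 2) ^ i) ((ε ^ 2) ^ K * s ε))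
    (hp : Tendsto s (𝓝[>] 0) (𝓝 p)) : (∀ k < K, m k = 0) ∧ m K = p := by
  have key : ∀ k ≤ K, (∀ i < k, m i = 0) →
      Tendsto (fun ε : ℝ => (ε ^ 2) ^ (K - k) * s ε) (𝓝[>] 0) (𝓝 (m k)) := by
    intro k hk hm
    rw [tendsto_iff_norm_sub_tendsto_zero]
    have hlim : Tendsto (fun ε : ℝ => (∑' i, B i) / τ ^ (k + 1) * ε ^ 2) (𝓝[>] 0) (𝓝 0) := by
      simpa using tendsto_sq_nhdsGT_zero.const_mul ((∑' i, B i) / τ ^ (k + 1))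
    refine squeeze_zero' (.of_forall fun _ => norm_nonneg _) ?_ hlim
    filter_upwards [eventually_sq_le hτ] with ε hε
    have ht : 0 < ε ^ 2 := pow_pos hε.1 2
    have h1 := abs_hasSum_sub_leading_le ht hε.2 hB hmB (hs ε hε.1 hε.2) hm
    have h2 : (ε ^ 2) ^ K * s ε - m k * (ε ^ 2) ^ k =
        (ε ^ 2) ^ k * ((ε ^ 2) ^ (K - k) * s ε - m k) := by
      rw [mul_sub, ← mul_assoc, ← pow_add, Nat.add_sub_cancel' hk]; ring
    rw [h2, abs_mul, abs_of_pos (pow_pos ht k), pow_succ (ε ^ 2) k, mul_left_comm] at h1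
    exact le_of_mul_le_mul_left h1 (pow_pos ht k)
  have hzero : ∀ k < K, m k = 0 := by
    intro k
    induction k using Nat.strong_induction_on with
    | _ k ih =>
      intro hk
      refine tendsto_nhds_unique (key k hk.le fun i hi => ih i hi (hi.trans hk)) ?_
      have h := (tendsto_sq_nhdsGT_zero.pow (K - k)).mul hp
      rwa [zero_pow (Nat.sub_pos_of_lt hk).ne', zero_mul] at h
  refine ⟨hzero, tendsto_nhds_unique (key K le_rfl hzero) ?_⟩
  simpa using hp

/-! ### The interpolant differs from its flat limit -/

/-- An interpolant to nonzero data does not agree with a polynomial on large balls: a high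
difference along a line annihilates the polynomial, and the differences of the interpolant form a
nontrivial combination of kernel translates that would vanish at all its centers. -/
theorem exists_radius_kernelInterpolant_ne {d n : ℕ} (hd : 0 < d) {φ : ℝ → ℝ}
    (hposdef : IsPositiveDefiniteKernel d φ) {x : Fin n → EuclideanSpace ℝ (Fin d)}
    (hx : Function.Injective x) {y : Fin n → ℝ} (hy : y ≠ 0) (P : MvPolynomial (Fin d) ℝ) :
    ∃ R : ℝ, ∀ ε, 0 < ε → ∃ z : EuclideanSpace ℝ (Fin d), ‖z‖ ≤ R ∧
      kernelInterpolant φ ε x y z ≠ MvPolynomial.eval (fun i => z i) P := by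
  obtain ⟨S, hS0, hS⟩ : ∃ S, 0 ≤ S ∧ ∀ j, ‖x j‖ ≤ S :=
    ⟨∑ i, ‖x i‖, Finset.sum_nonneg fun _ _ => norm_nonneg _,
      fun j => Finset.single_le_sum (f := fun i => ‖x i‖)
      (fun _ _ => norm_nonneg _) (Finset.mem_univ j)⟩
  -- A step longer than the diameter of the nodes keeps all shifted nodes distinct.
  set v : EuclideanSpace ℝ (Fin d) := EuclideanSpace.single ⟨0, hd⟩ (2 * S + 1) with hv
  have hvn : ‖v‖ = 2 * S + 1 := by
    rw [hv, PiLp.norm_single, Real.norm_of_nonneg (by positivity)]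
  have hg : ∀ i, ∃ g : Polynomial ℝ, ∀ r : ℝ,
      g.eval r = MvPolynomial.eval (fun l => (x i + r • v) l) P := fun i => by
    refine ⟨MvPolynomial.aeval (fun l => Polynomial.C (x i l) + Polynomial.X * Polynomial.C (v l)) P,
      fun r => ?_⟩
    rw [← Polynomial.coe_evalRingHom, MvPolynomial.aeval_def, MvPolynomial.hom_eval₂]
    rw [MvPolynomial.eval, MvPolynomial.coe_eval₂Hom]
    congr 1
    · ext; simp
    · funext l; simp; ring
  choose g hg using hg
  set m : ℕ := (∑ i, (g i).natDegree) + 1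
  have hm : ∀ i, (g i).natDegree < m := fun i => Nat.lt_succ_of_le
    (Finset.single_le_sum (f := fun i => (g i).natDegree) (fun _ _ => Nat.zero_le _)
      (Finset.mem_univ i))
  refine ⟨S + m * (2 * S + 1), fun ε hε => ?_⟩
  by_contra! hcon
  set α := (kernelMatrix φ ε x)⁻¹.mulVec y with hα
  set b : ℕ → ℝ := fun k => (-1) ^ (m - k) * (m.choose k : ℝ) with hb
  set u : Fin n × Fin (m + 1) → EuclideanSpace ℝ (Fin d) :=
    fun q => x q.1 - (q.2 : ℝ) • v with hu
  have huinj : Function.Injective u := by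
    rintro ⟨i, k⟩ ⟨j, l⟩ h
    have h1 : x i - x j = ((k : ℝ) - (l : ℝ)) • v := by
      rw [sub_smul, sub_eq_sub_iff_add_eq_add]
      have h2 : x i - (k : ℝ) • v = x j - (l : ℝ) • v := h
      rw [sub_eq_sub_iff_add_eq_add] at h2
      rw [h2, add_comm]
    have hkl : (k : ℕ) = l := by
      by_contra hne
      have h2 : (1 : ℝ) ≤ |(k : ℝ) - (l : ℝ)| := by
        have : (1 : ℤ) ≤ |(k : ℤ) - (l : ℤ)| := Int.one_le_abs (by omega)
        exact_mod_cast this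
      have h3 : ‖x i - x j‖ ≤ S + S := (norm_sub_le _ _).trans (add_le_add (hS i) (hS j))
      rw [h1, norm_smul, hvn, Real.norm_eq_abs] at h3
      nlinarith
    rw [hkl, sub_self, zero_smul, sub_eq_zero] at h1
    exact Prod.ext (hx h1) (Fin.ext hkl)
  have hβ := eq_zero_of_sum_scaledKernel_eq_zero hposdef hε huinj (fun q => α q.1 * b q.2) (by
    rintro ⟨i, l⟩
    have hrow : ∀ k : Fin (m + 1),
        ∑ j, α j * scaledKernel φ ε (u (i, l)) (u (j, k)) = (g i).eval (-(l : ℝ) + (k : ℝ)) := by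
      intro k
      have hz : ‖x i + (-(l : ℝ) + (k : ℝ)) • v‖ ≤ S + m * (2 * S + 1) := by
        refine (norm_add_le _ _).trans (add_le_add (hS i) ?_)
        rw [norm_smul, hvn, Real.norm_eq_abs]
        refine mul_le_mul_of_nonneg_right ?_ (by positivity)
        have hl : (l : ℝ) ≤ m := by exact_mod_cast Nat.le_of_lt_succ l.2
        have hk : (k : ℝ) ≤ m := by exact_mod_cast Nat.le_of_lt_succ k.2
        have hl0 : (0 : ℝ) ≤ l := Nat.cast_nonneg _
        have hk0 : (0 : ℝ) ≤ k := Nat.cast_nonneg _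
        rw [abs_le]
        constructor <;> linarith
      rw [hg, ← hcon _ hz, kernelInterpolant]
      refine Finset.sum_congr rfl fun j _ => ?_
      have hsub : u (i, l) - u (j, k) = x i + (-(l : ℝ) + (k : ℝ)) • v - x j := by
        simp only [hu]
        module
      rw [scaledKernel, scaledKernel, hsub]
    have hdiff := congrFun (Polynomial.fwdDiff_iter_eq_zero_of_degree_lt (hm i)) (-(l : ℝ))
    rw [fwdDiff_iter_eq_sum_shift, Finset.sum_range, Pi.zero_apply] at hdiff
    rw [Fintype.sum_prod_type_right, ← hdiff]
    refine Finset.sum_congr rfl fun k _ => ?_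
    have hk := hrow k
    simp only [nsmul_eq_mul, mul_one, zsmul_eq_mul]
    rw [← hk, Finset.mul_sum]
    refine Finset.sum_congr rfl fun j _ => ?_
    simp only [hb]
    push_cast
    ring)
  have hα0 : α = 0 := by
    funext j
    have h := congrFun hβ (j, Fin.last m)
    simpa [hb] using h
  refine hy (funext fun i => ?_)
  rw [← kernelInterpolant_apply_node hposdef hε hx y i, kernelInterpolant, ← hα, hα0]
  simp

/-- The flat limit is a polynomial, and it is approached, uniformly on balls, along a nonzero
polynomial `Q` at some positive even order in `ε`. In the power series of the interpolant `P` is the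
constant term and `Q` the next nonzero coefficient; if there were none, the interpolants would agree
with `P` on large balls for small `ε`. -/
theorem exists_flat_expansion {d n : ℕ} (hd : 0 < d) {φ : ℝ → ℝ} (hanalytic : IsAnalyticKernel φ)
    (hposdef : IsPositiveDefiniteKernel d φ) {x : Fin n → EuclideanSpace ℝ (Fin d)}
    (hx : Function.Injective x) {y : Fin n → ℝ} (hy : y ≠ 0)
    {p₀ : EuclideanSpace ℝ (Fin d) → ℝ} (hflat : IsFlatLimit φ x y p₀) :
    ∃ (P Q : MvPolynomial (Fin d) ℝ) (m : ℕ), 0 < m ∧ Q ≠ 0 ∧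
      (∀ z, p₀ z = MvPolynomial.eval (fun i => z i) P) ∧
      ∀ R : ℝ, ∃ C : ℝ, ∀ᶠ ε in 𝓝[>] (0 : ℝ), ∀ z : EuclideanSpace ℝ (Fin d), ‖z‖ ≤ R →
        |kernelInterpolant φ ε x y z - p₀ z - (ε ^ 2) ^ m * MvPolynomial.eval (fun i => z i) Q| ≤
          C * (ε ^ 2) ^ (m + 1) := by
  obtain ⟨K, M, hM⟩ := exists_hasSum_kernelInterpolant hanalytic hposdef hx y
  have hcoeff : ∀ z : EuclideanSpace ℝ (Fin d),
      (∀ k < K, MvPolynomial.eval (fun i => z i) (M k) = 0) ∧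
        MvPolynomial.eval (fun i => z i) (M K) = p₀ z := by
    intro z
    obtain ⟨τ, B, hτ, hB, hMB, hs⟩ := hM ‖z‖
    exact coeff_eq_of_tendsto hτ hB (hMB z le_rfl) (hs z le_rfl) (hflat z)
  have hex : ∃ m, 0 < m ∧ M (K + m) ≠ 0 := by
    by_contra! hall
    obtain ⟨R, hR⟩ := exists_radius_kernelInterpolant_ne hd hposdef hx hy (M K)
    obtain ⟨τ, B, hτ, -, -, hs⟩ := hM R
    obtain ⟨ε, hε, hετ⟩ := (eventually_sq_le hτ).exists
    obtain ⟨z, hz, hne⟩ := hR ε hε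
    refine hne ?_
    have h1 := (hs z hz ε hε hετ).unique (hasSum_single K fun k hk => ?_)
    · rw [mul_comm] at h1
      exact mul_right_cancel₀ (by positivity) h1
    · rcases lt_or_gt_of_ne hk with h | h
      · rw [(hcoeff z).1 k h, zero_mul]
      · have h2 := hall (k - K) (Nat.sub_pos_of_lt h)
        rw [Nat.add_sub_cancel' h.le] at h2
        simp [h2]
  classical
  obtain ⟨hm0, hmne⟩ := Nat.find_spec hex
  set m := Nat.find hex
  refine ⟨M K, M (K + m), m, hm0, hmne, fun z => (hcoeff z).2.symm, fun R => ?_⟩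
  obtain ⟨τ, B, hτ, hB, hMB, hs⟩ := hM R
  refine ⟨(∑' i, B i) / τ ^ (K + m + 1), ?_⟩
  filter_upwards [eventually_sq_le hτ] with ε hε z hz
  have ht : 0 < ε ^ 2 := pow_pos hε.1 2
  -- Remove the term of order `K` from the series; the next nonzero one has order `K + m`.
  set e : ℕ → ℝ := fun k => if k = K then 0 else MvPolynomial.eval (fun i => z i) (M k) with he
  have hesum : HasSum (fun k => e k * (ε ^ 2) ^ k)
      ((ε ^ 2) ^ K * (kernelInterpolant φ ε x y z - p₀ z)) := by
    rw [mul_sub, mul_comm _ (p₀ z)]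
    have hek : (fun k => e k * (ε ^ 2) ^ k) = fun k =>
        MvPolynomial.eval (fun i => z i) (M k) * (ε ^ 2) ^ k -
          if k = K then p₀ z * (ε ^ 2) ^ K else 0 := by
      funext k
      by_cases hk : k = K
      · simp [he, hk, (hcoeff z).2]
      · simp [he, hk]
    rw [hek]
    exact (hs z hz ε hε.1 hε.2).sub (hasSum_ite_eq K (p₀ z * (ε ^ 2) ^ K))
  have heB : ∀ k, |e k| * τ ^ k ≤ B k := fun k => by
    refine le_trans (mul_le_mul_of_nonneg_right ?_ (by positivity)) (hMB z hz k)
    by_cases hk : k = K <;> simp [he, hk]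
  have he0 : ∀ k < K + m, e k = 0 := by
    intro k hk
    rcases lt_trichotomy k K with h | h | h
    · simp [he, (hcoeff z).1 k h]
    · simp [he, h]
    · have h1 := Nat.find_min hex (m := k - K) (by omega)
      push Not at h1
      have h2 := h1 (by omega)
      rw [Nat.add_sub_cancel' h.le] at h2
      simp [he, h2]
  have h1 := abs_hasSum_sub_leading_le ht hε.2 hB heB hesum he0
  have h2 : e (K + m) = MvPolynomial.eval (fun i => z i) (M (K + m)) := by
    simp [he, hm0.ne']
  rw [h2, show (ε ^ 2) ^ K * (kernelInterpolant φ ε x y z - p₀ z) -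
      MvPolynomial.eval (fun i => z i) (M (K + m)) * (ε ^ 2) ^ (K + m) =
      (ε ^ 2) ^ K * (kernelInterpolant φ ε x y z - p₀ z -
        (ε ^ 2) ^ m * MvPolynomial.eval (fun i => z i) (M (K + m))) by rw [pow_add]; ring,
    abs_mul, abs_of_pos (pow_pos ht K), add_assoc K m 1, pow_add (ε ^ 2) K, mul_left_comm] at h1
  exact le_of_mul_le_mul_left h1 (pow_pos ht K)

/-! ### Errors of the flat limit -/

theorem MvPolynomial.exists_mem_eval_ne_zero {d : ℕ} {Q : MvPolynomial (Fin d) ℝ} (hQ : Q ≠ 0)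
    {U : Set (EuclideanSpace ℝ (Fin d))} (hU : IsOpen U) (hne : U.Nonempty) :
    ∃ z ∈ U, MvPolynomial.eval (fun i => z i) Q ≠ 0 := by
  by_contra! h
  obtain ⟨w, hw⟩ := hne
  have hV : IsOpen ((fun v : Fin d → ℝ => WithLp.toLp 2 v) ⁻¹' U) :=
    hU.preimage (PiLp.continuous_toLp 2 _)
  obtain ⟨r, hr, hball⟩ := Metric.isOpen_iff.1 hV (WithLp.ofLp w) (by simpa using hw)
  refine hQ (MvPolynomial.funext_set (fun i => Metric.ball (w i) r) (fun i => ?_) fun v hv => ?_)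
  · rw [Real.ball_eq_Ioo]
    exact Set.Ioo_infinite (by linarith)
  · rw [← ball_pi _ hr] at hv
    simpa using h _ (hball hv)

theorem mainTheorem3 {d n : ℕ} (hd : 0 < d) (φ : ℝ → ℝ)
    (hanalytic : IsAnalyticKernel φ) (hposdef : IsPositiveDefiniteKernel d φ)
    (x : Fin n → EuclideanSpace ℝ (Fin d)) (hx : Function.Injective x)
    (y : Fin n → ℝ) (hy : y ≠ 0)
    (p₀ : EuclideanSpace ℝ (Fin d) → ℝ) (hflat : IsFlatLimit φ x y p₀)
    (Ω : Set (EuclideanSpace ℝ (Fin d))) (hΩ : IsCompact Ω) (hΩ' : (interior Ω).Nonempty) :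
    -- a function with these data for which the flat limit is optimal among all scales
    (∃ f : EuclideanSpace ℝ (Fin d) → ℝ, IsPolynomialFun f ∧ (∀ j, f (x j) = y j) ∧
      IsFlatLimitOptimal φ x y p₀ Ω f) ∧
    -- one not reproduced by the flat limit, which still beats all sufficiently small scales
    (∃ f : EuclideanSpace ℝ (Fin d) → ℝ, IsPolynomialFun f ∧ (∀ j, f (x j) = y j) ∧
      0 < supError Ω f p₀ ∧
      ∀ᶠ ε in 𝓝[>] (0 : ℝ), supError Ω f p₀ < supError Ω f (kernelInterpolant φ ε x y)) ∧
    -- one for which it is not optimal: all sufficiently small scales are strictly better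
    (∃ f : EuclideanSpace ℝ (Fin d) → ℝ, IsPolynomialFun f ∧ (∀ j, f (x j) = y j) ∧
      ¬ IsFlatLimitOptimal φ x y p₀ Ω f ∧
      ∀ᶠ ε in 𝓝[>] (0 : ℝ), supError Ω f (kernelInterpolant φ ε x y) < supError Ω f p₀) := by
  obtain ⟨P, Q, m, -, hQ, hP, hexp⟩ := exists_flat_expansion hd hanalytic hposdef hx hy hflat
  set q : EuclideanSpace ℝ (Fin d) → ℝ := fun z => MvPolynomial.eval (fun i => z i) Q with hq
  have hqcont : Continuous q :=
    (MvPolynomial.continuous_eval Q).comp (PiLp.continuous_ofLp 2 _)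
  -- The data are reproduced by `p₀`, and `q` vanishes at the nodes.
  have hnode : ∀ j, p₀ (x j) = y j := fun j => by
    refine tendsto_nhds_unique (hflat (x j)) (tendsto_const_nhds.congr' ?_)
    filter_upwards [self_mem_nhdsWithin] with ε hε
    exact (kernelInterpolant_apply_node hposdef hε hx y j).symm
  have hqnode : ∀ j, q (x j) = 0 := fun j => by
    obtain ⟨C, hC⟩ := hexp ‖x j‖
    have hlim : Tendsto (fun ε : ℝ => C * ε ^ 2) (𝓝[>] 0) (𝓝 0) := by
      simpa using tendsto_sq_nhdsGT_zero.const_mul C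
    refine abs_nonpos_iff.1 (ge_of_tendsto hlim ?_)
    filter_upwards [hC, self_mem_nhdsWithin] with ε hε hpos
    have ht : 0 < (ε ^ 2) ^ m := pow_pos (pow_pos hpos 2) m
    have h1 := hε (x j) le_rfl
    rw [kernelInterpolant_apply_node hposdef hpos hx y j, hnode j, sub_self, zero_sub, abs_neg,
      abs_mul, abs_of_pos ht, pow_succ (ε ^ 2) m, mul_left_comm] at h1
    exact le_of_mul_le_mul_left h1 ht
  obtain ⟨z₀, hz₀, hmax⟩ := hΩ.exists_isMaxOn (hΩ'.mono interior_subset)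
    (hqcont.abs.continuousOn (s := Ω))
  have hmax : ∀ z ∈ Ω, |q z| ≤ |q z₀| := hmax
  have hpos : 0 < |q z₀| := by
    obtain ⟨w, hw, hwne⟩ := MvPolynomial.exists_mem_eval_ne_zero hQ isOpen_interior hΩ'
    exact (abs_pos.2 hwne).trans_le (hmax w (interior_subset hw))
  -- On `Ω` the interpolant is `p₀ + δ (q + o(1))` with `δ = (ε²)^m`.
  obtain ⟨R, hR⟩ := hΩ.isBounded.exists_norm_le
  have hrem : ∀ᶠ ε in 𝓝[>] (0 : ℝ), ∃ δ : ℝ, 0 < δ ∧ δ ≤ 1 ∧ ∀ z ∈ Ω,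
      |kernelInterpolant φ ε x y z - p₀ z - δ * q z| ≤ δ * (|q z₀| / 2) := by
    obtain ⟨C, hC⟩ := hexp R
    have hlim : Tendsto (fun ε : ℝ => C * ε ^ 2) (𝓝[>] 0) (𝓝 0) := by
      simpa using tendsto_sq_nhdsGT_zero.const_mul C
    filter_upwards [hC, self_mem_nhdsWithin, hlim.eventually_le_const (half_pos hpos),
      eventually_sq_le one_pos] with ε hε h0 hsmall hone
    have ht : 0 < (ε ^ 2) ^ m := pow_pos (pow_pos h0 2) m
    refine ⟨(ε ^ 2) ^ m, ht, pow_le_one₀ (sq_nonneg ε) hone.2, fun z hz => ?_⟩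
    refine (hε z (hR z hz)).trans ?_
    rw [pow_succ (ε ^ 2) m, mul_left_comm]
    exact mul_le_mul_of_nonneg_left hsmall ht.le
  have hsup : ∀ f : EuclideanSpace ℝ (Fin d) → ℝ, (∀ z, |f z - p₀ z| = |q z|) →
      supError Ω f p₀ = ENNReal.ofReal |q z₀| := by
    intro f hf
    refine le_antisymm (iSup₂_le fun z hz => ?_) ?_
    · rw [Real.enorm_eq_ofReal_abs, hf]
      exact ENNReal.ofReal_le_ofReal (hmax z hz)
    · refine le_trans ?_ (le_iSup₂ (f := fun z _ => ‖f z - p₀ z‖ₑ) z₀ hz₀)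
      rw [Real.enorm_eq_ofReal_abs, hf]
  refine ⟨⟨p₀, ⟨P, hP⟩, hnode, fun ε _ => ?_⟩, ?_, ?_⟩
  · simp [supError]
  · -- The error `-q` of `p₀ - q` is enlarged by the perturbation `δ q`.
    have h0 := hsup (fun z => p₀ z - q z) fun z => by rw [sub_sub_cancel_left, abs_neg]
    refine ⟨fun z => p₀ z - q z, ⟨P - Q, fun z => by simp [hP, hq]⟩,
      fun j => by simp [hnode, hqnode], ?_, ?_⟩
    · rw [h0]; exact ENNReal.ofReal_pos.2 hpos
    · filter_upwards [hrem] with ε ⟨δ, hδ, _, hε⟩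
      rw [h0]
      refine lt_of_lt_of_le ?_ (le_iSup₂
        (f := fun z _ => ‖p₀ z - q z - kernelInterpolant φ ε x y z‖ₑ) z₀ hz₀)
      rw [Real.enorm_eq_ofReal_abs]
      refine (ENNReal.ofReal_lt_ofReal_iff_of_nonneg hpos.le).2 ?_
      have h1 := hε z₀ hz₀
      have h2 : (1 + δ) * |q z₀| = |(p₀ z₀ - q z₀ - kernelInterpolant φ ε x y z₀) +
          (kernelInterpolant φ ε x y z₀ - p₀ z₀ - δ * q z₀)| := by
        rw [← abs_of_pos (show 0 < 1 + δ by linarith), ← abs_mul, ← abs_neg]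
        congr 1
        ring
      have h3 := abs_add_le (p₀ z₀ - q z₀ - kernelInterpolant φ ε x y z₀)
          (kernelInterpolant φ ε x y z₀ - p₀ z₀ - δ * q z₀)
      nlinarith
  · -- The error `q` of `p₀ + q` is reduced by the perturbation `δ q`.
    have h0 := hsup (fun z => p₀ z + q z) fun z => by rw [add_sub_cancel_left]
    have hlt : ∀ᶠ ε in 𝓝[>] (0 : ℝ),
        supError Ω (fun z => p₀ z + q z) (kernelInterpolant φ ε x y) <
          supError Ω (fun z => p₀ z + q z) p₀ := by
      filter_upwards [hrem] with ε ⟨δ, hδ, hδ1, hε⟩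
      rw [h0]
      refine lt_of_le_of_lt (iSup₂_le fun z hz => ?_)
        ((ENNReal.ofReal_lt_ofReal_iff hpos).2
          (show (1 - δ) * |q z₀| + δ * (|q z₀| / 2) < |q z₀| by nlinarith))
      rw [Real.enorm_eq_ofReal_abs]
      refine ENNReal.ofReal_le_ofReal ?_
      rw [show p₀ z + q z - kernelInterpolant φ ε x y z = (1 - δ) * q z -
        (kernelInterpolant φ ε x y z - p₀ z - δ * q z) by ring]
      refine (abs_sub _ _).trans (add_le_add ?_ (hε z hz))
      rw [abs_mul, abs_of_nonneg (by linarith)]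
      exact mul_le_mul_of_nonneg_left (hmax z hz) (by linarith)
    refine ⟨fun z => p₀ z + q z, ⟨P + Q, fun z => by simp [hP, hq]⟩,
      fun j => by simp [hnode, hqnode], fun hopt => ?_, hlt⟩
    obtain ⟨ε, hε, h0ε⟩ := (hlt.and self_mem_nhdsWithin).exists
    exact (hopt ε h0ε).not_gt hε
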